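/- Let $E$ and $F$ be Banach spaces over the same field $\mathbb{R}$ or $\mathbb{C}$. An extension of $E$ by $F$ is a short exact sequence $0\to E\xrightarrow{\,i\,} G\xrightarrow{\,\sigma\,} F\to 0$ of Banach spaces and bounded linear operators; two extensions with middle spaces $G_1,G_2$ are congruent if there is a linear homeomorphism $h:G_1\to G_2$ with $h i_1=i_2$ and $\sigma_2 h=\sigma_1$. Let $\mathrm{Ext}^1(F,E)$ be the set of congruence classes of extensions of $E$ by $F$. It is a vector space: the sum is the Baer sum (middle space $\{(g_1,g_2)\in G_1\times G_2:\sigma_1g_1=\sigma_2g_2\}/\{(i_1e,-i_2e):e\in E\}$), the multiple $\lambda\alpha$ is the push-out of $\alpha$ along $\lambda I_E$ (middle space $(G\times E)/\{(ie,-\lambda e):e\in E\}$), and zero is the class of the split extension $E\times F$. A Banach space $X$ has the approximation property (AP) if for every compact $K\subset X$ and every $\varepsilon>0$ there is a bounded finite-rank operator $T$ on $X$ with $\|Tx-x\|<\varepsilon$ for all $x\in K$; it has the bounded approximation property (BAP) if there is a constant $C$ such that $T$ can always be chosen with $\|T\|\le C$. Suppose that at least one of the following conditions holds: 1. $E$ is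 reflexive and has the AP; 2. $E$ is isomorphic to the dual of a Banach space, and $F$ has the BAP. Then either $\mathrm{Ext}^1(F,E)=0$ or $\dim\mathrm{Ext}^1(F,E)=\infty$. -/

import Mathlib

universe u v

set_option linter.unusedSectionVars false

/-- A **Banach space extension of `E` by `F`**: a short exact sequence
`0 → E --i--> G --σ--> F → 0` of Banach spaces and bounded linear operators.
(Every such middle space `G` has the cardinality of `E × F`, so that nothing is lost by
taking it in the universe `max u v` of `E × F`.) -/
structure BanExtension (𝕜 : Type*) [RCLike 𝕜]
    (F : Type v) [NormedAddCommGroup F] [NormedSpace 𝕜 F]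
    (E : Type u) [NormedAddCommGroup E] [NormedSpace 𝕜 E] where
  G : Type (max u v)
  [instGroup : NormedAddCommGroup G]
  [instSpace : NormedSpace 𝕜 G]
  [instComplete : CompleteSpace G]
  i : E →L[𝕜] G
  σ : G →L[𝕜] F
  injective : Function.Injective i
  exact : i.range = σ.ker
  surjective : Function.Surjective σ

attribute [instance] BanExtension.instGroup BanExtension.instSpace BanExtension.instComplete

namespace BanExtension

section

variable {𝕜 : Type*} [RCLike 𝕜]
  {F : Type v} [NormedAddCommGroup F] [NormedSpace 𝕜 F]
  {E : Type u} [NormedAddCommGroup E] [NormedSpace 𝕜 E]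

theorem σ_i (α : BanExtension 𝕜 F E) (e : E) : α.σ (α.i e) = 0 := by
  have : α.i e ∈ α.i.range := ⟨e, rfl⟩
  rw [α.exact] at this
  exact this

theorem exists_of_σ_eq_zero (α : BanExtension 𝕜 F E) {g : α.G} (h : α.σ g = 0) :
    ∃ e, α.i e = g := by
  have : g ∈ α.i.range := by rw [α.exact]; exact h
  exact this

/-- Two extensions of `E` by `F` are **congruent** if there is an isomorphism (linear
homeomorphism) of the middle spaces that induces the identity on `E` and on `F`. -/
def Congruent (α β : BanExtension 𝕜 F E) : Prop :=
  ∃ h : α.G ≃L[𝕜] β.G, (∀ e, h (α.i e) = β.i e) ∧ ∀ g, β.σ (h g) = α.σ g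

theorem Congruent.refl (α : BanExtension 𝕜 F E) : Congruent α α :=
  ⟨ContinuousLinearEquiv.refl 𝕜 α.G, fun _ => rfl, fun _ => rfl⟩

theorem Congruent.symm {α β : BanExtension 𝕜 F E} (h : Congruent α β) : Congruent β α := by
  obtain ⟨h, h1, h2⟩ := h
  refine ⟨h.symm, fun e => ?_, fun g => ?_⟩
  · rw [← h1, h.symm_apply_apply]
  · rw [← h2, h.apply_symm_apply]

theorem Congruent.trans {α β γ : BanExtension 𝕜 F E} (h : Congruent α β)
    (k : Congruent β γ) : Congruent α γ := by
  obtain ⟨h, h1, h2⟩ := h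
  obtain ⟨k, k1, k2⟩ := k
  refine ⟨h.trans k, fun e => ?_, fun g => ?_⟩
  · simp [h1, k1]
  · simp [h2, k2]

end

/-- The congruence relation on the extensions of `E` by `F`. -/
instance setoid (𝕜 : Type*) [RCLike 𝕜]
    (F : Type v) [NormedAddCommGroup F] [NormedSpace 𝕜 F]
    (E : Type u) [NormedAddCommGroup E] [NormedSpace 𝕜 E] :
    Setoid (BanExtension 𝕜 F E) where
  r := Congruent
  iseqv := ⟨Congruent.refl, Congruent.symm, Congruent.trans⟩

section

variable {𝕜 : Type*} [RCLike 𝕜]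
  {F : Type v} [NormedAddCommGroup F] [NormedSpace 𝕜 F]
  {E : Type u} [NormedAddCommGroup E] [NormedSpace 𝕜 E] [CompleteSpace E]

/-- The operator `i` of an extension is bounded below. -/
theorem exists_bound (α : BanExtension 𝕜 F E) : ∃ C : ℝ, 0 ≤ C ∧ ∀ e, ‖e‖ ≤ C * ‖α.i e‖ := by
  have hc : IsClosed (Set.range α.i) := by
    have h : (Set.range α.i) = (α.σ.ker : Set α.G) := by
      rw [← α.exact]; rfl
    rw [h]
    exact α.σ.isClosed_ker
  obtain ⟨c, hl⟩ := α.i.antilipschitz_of_injective_of_isClosed_range α.injective hc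
  exact ⟨c, c.2, fun e => α.i.bound_of_antilipschitz hl e⟩

/-- If `q ∘ f = i` is the embedding of an extension, then `f` has closed range. -/
theorem isClosed_range_of_comp (α : BanExtension 𝕜 F E) {Y : Type*} [NormedAddCommGroup Y]
    [NormedSpace 𝕜 Y] (f : E →L[𝕜] Y) (q : Y →L[𝕜] α.G) (h : ∀ e, q (f e) = α.i e) :
    IsClosed (f.range : Set Y) := by
  obtain ⟨C, hC, hb⟩ := α.exists_bound
  have ha : AntilipschitzWith (Real.toNNReal (C * ‖q‖)) f := by
    refine AddMonoidHomClass.antilipschitz_of_bound f fun e => ?_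
    rw [Real.coe_toNNReal _ (by positivity)]
    calc ‖e‖ ≤ C * ‖α.i e‖ := hb e
      _ ≤ C * (‖q‖ * ‖f e‖) := by
        rw [← h]
        exact mul_le_mul_of_nonneg_left (q.le_opNorm _) hC
      _ = C * ‖q‖ * ‖f e‖ := by ring
  exact ha.isClosed_range f.uniformContinuous

/-! ### Scalar multiples: the push-out along `a • id : E → E` -/

/-- The operator `e ↦ (i e, - a e)`. -/
def smulRel (a : 𝕜) (α : BanExtension 𝕜 F E) : E →L[𝕜] α.G × E :=
  α.i.prod (-(a • ContinuousLinearMap.id 𝕜 E))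

@[simp] theorem smulRel_apply (a : 𝕜) (α : BanExtension 𝕜 F E) (e : E) :
    smulRel a α e = (α.i e, -(a • e)) := rfl

instance (a : 𝕜) (α : BanExtension 𝕜 F E) :
    IsClosed ((smulRel a α).range : Set (α.G × E)) :=
  α.isClosed_range_of_comp (smulRel a α) (ContinuousLinearMap.fst 𝕜 α.G E) fun _ => rfl

/-- The multiple `a α` of an extension `α`: the push-out of `α` along `a • id : E → E`.
Its middle space is the quotient of `G × E` by the space of all `(i e, - a e)`, the embedding
of `E` is `x ↦ [(0, x)]` and the projection onto `F` is `[(g, x)] ↦ σ g`. -/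
noncomputable def smul (a : 𝕜) (α : BanExtension 𝕜 F E) : BanExtension 𝕜 F E where
  G := (α.G × E) ⧸ (smulRel a α).range
  i := (smulRel a α).range.mkQL.comp (ContinuousLinearMap.inr 𝕜 α.G E)
  σ := (smulRel a α).range.liftQL (α.σ.comp (ContinuousLinearMap.fst 𝕜 α.G E)) (by
    rintro _ ⟨e, rfl⟩
    exact α.σ_i e)
  injective := by
    rw [injective_iff_map_eq_zero]
    intro x hx
    obtain ⟨e, he⟩ := (Submodule.Quotient.mk_eq_zero _).1 hx
    have h1 : α.i e = 0 := congrArg Prod.fst he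
    have h2 : -(a • e) = x := congrArg Prod.snd he
    have h3 : e = 0 := α.injective (by rw [h1, map_zero])
    rw [← h2, h3, smul_zero, neg_zero]
  exact := by
    ext y
    obtain ⟨⟨g, x⟩, rfl⟩ := Submodule.Quotient.mk_surjective _ y
    constructor
    · rintro ⟨x', hx'⟩
      rw [← hx']
      exact α.σ.map_zero
    · intro hy
      obtain ⟨e, he⟩ := α.exists_of_σ_eq_zero (g := g) hy
      refine ⟨x + a • e, ?_⟩
      refine ((Submodule.Quotient.eq _).2 ?_)
      refine ⟨-e, ?_⟩
      change (α.i (-e), -(a • -e)) = ((0 : α.G) - g, x + a • e - x)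
      simp [he]
  surjective := by
    intro y
    obtain ⟨g, hg⟩ := α.surjective y
    exact ⟨Submodule.Quotient.mk (g, 0), hg⟩

/-! ### Baer sums -/

/-- The fibre product `{(g₁, g₂) | σ₁ g₁ = σ₂ g₂}` of the middle spaces. -/
abbrev fibre (α β : BanExtension 𝕜 F E) : Submodule 𝕜 (α.G × β.G) :=
  (α.σ.comp (ContinuousLinearMap.fst 𝕜 α.G β.G) -
    β.σ.comp (ContinuousLinearMap.snd 𝕜 α.G β.G)).ker

theorem fibre_eq {α β : BanExtension 𝕜 F E} (p : fibre α β) : α.σ p.1.1 = β.σ p.1.2 :=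
  sub_eq_zero.1 p.2

instance (α β : BanExtension 𝕜 F E) : CompleteSpace (fibre α β) :=
  (ContinuousLinearMap.isClosed_ker _).completeSpace_coe

/-- The operator `e ↦ (i₁ e, - i₂ e)` into the fibre product. -/
def addRel (α β : BanExtension 𝕜 F E) : E →L[𝕜] fibre α β :=
  (α.i.prod (-β.i)).codRestrict (fibre α β) fun e => sub_eq_zero.2 (by
    change α.σ (α.i e) = β.σ (-(β.i e))
    rw [map_neg, σ_i, σ_i, neg_zero])

@[simp] theorem addRel_coe (α β : BanExtension 𝕜 F E) (e : E) :
    (addRel α β e : α.G × β.G) = (α.i e, -(β.i e)) := rfl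

instance (α β : BanExtension 𝕜 F E) : IsClosed ((addRel α β).range : Set (fibre α β)) :=
  α.isClosed_range_of_comp (addRel α β)
    ((ContinuousLinearMap.fst 𝕜 α.G β.G).comp (fibre α β).subtypeL) fun _ => rfl

/-- The embedding `e ↦ (i₁ e, 0)` into the fibre product. -/
def addInl (α β : BanExtension 𝕜 F E) : E →L[𝕜] fibre α β :=
  (α.i.prod 0).codRestrict (fibre α β) fun e => sub_eq_zero.2 (by
    change α.σ (α.i e) = β.σ 0
    rw [map_zero, σ_i])

/-- The projection `(g₁, g₂) ↦ σ₁ g₁ = σ₂ g₂` of the fibre product onto `F`. -/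
def addProj (α β : BanExtension 𝕜 F E) : fibre α β →L[𝕜] F :=
  (α.σ.comp (ContinuousLinearMap.fst 𝕜 α.G β.G)).comp (fibre α β).subtypeL

/-- The **Baer sum** of two extensions `α` and `β` of `E` by `F`. Its middle space is the
quotient of the fibre product `{(g₁, g₂) | σ₁ g₁ = σ₂ g₂}` by the space of all
`(i₁ e, - i₂ e)`, the embedding of `E` is `e ↦ [(i₁ e, 0)] = [(0, i₂ e)]` and the projection
onto `F` is `[(g₁, g₂)] ↦ σ₁ g₁ = σ₂ g₂`. -/
noncomputable def add (α β : BanExtension 𝕜 F E) : BanExtension 𝕜 F E where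
  G := fibre α β ⧸ (addRel α β).range
  i := (addRel α β).range.mkQL.comp (addInl α β)
  σ := (addRel α β).range.liftQL (addProj α β) (by
    rintro _ ⟨e, rfl⟩
    exact α.σ_i e)
  injective := by
    rw [injective_iff_map_eq_zero]
    intro x hx
    obtain ⟨e, he⟩ := (Submodule.Quotient.mk_eq_zero _).1 hx
    have h1 : α.i e = α.i x := congrArg (fun p : fibre α β => p.1.1) he
    have h2 : -(β.i e) = 0 := congrArg (fun p : fibre α β => p.1.2) he
    have h3 : e = 0 := β.injective (by rw [neg_eq_zero.1 h2, map_zero])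
    rw [← α.injective h1, h3]
  exact := by
    ext y
    obtain ⟨p, rfl⟩ := Submodule.Quotient.mk_surjective _ y
    constructor
    · rintro ⟨e, he⟩
      rw [← he]
      exact α.σ_i e
    · intro hy
      have hp : α.σ p.1.1 = 0 := hy
      obtain ⟨e, he⟩ := α.exists_of_σ_eq_zero hp
      obtain ⟨e', he'⟩ := β.exists_of_σ_eq_zero (g := p.1.2) (by rw [← fibre_eq, hp])
      refine ⟨e + e', ?_⟩
      refine (Submodule.Quotient.eq _).2 ⟨e', Subtype.ext (Prod.ext ?_ ?_)⟩
      · change α.i e' = α.i (e + e') - p.1.1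
        rw [map_add, he, add_sub_cancel_left]
      · change -(β.i e') = 0 - p.1.2
        rw [he', zero_sub]
  surjective := by
    intro y
    obtain ⟨g, hg⟩ := α.surjective y
    obtain ⟨g', hg'⟩ := β.surjective y
    exact ⟨Submodule.Quotient.mk ⟨(g, g'), sub_eq_zero.2 (hg.trans hg'.symm)⟩, hg⟩

variable [CompleteSpace F]

/-- The trivial (split) extension `0 → E → E × F → F → 0`. -/
def split (𝕜 : Type*) [RCLike 𝕜]
    (F : Type v) [NormedAddCommGroup F] [NormedSpace 𝕜 F] [CompleteSpace F]
    (E : Type u) [NormedAddCommGroup E] [NormedSpace 𝕜 E] [CompleteSpace E] :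
    BanExtension 𝕜 F E where
  G := E × F
  i := ContinuousLinearMap.inl 𝕜 E F
  σ := ContinuousLinearMap.snd 𝕜 E F
  injective := fun x y h => congrArg Prod.fst h
  exact := by
    ext ⟨x, y⟩
    constructor
    · rintro ⟨e, he⟩
      exact (congrArg Prod.snd he).symm
    · intro h
      exact ⟨x, Prod.ext rfl (Eq.symm h)⟩
  surjective := fun y => ⟨(0, y), rfl⟩

/-! ### The vector space axioms

The operations above are compared by means of the failure of linearity of a (nonlinear)
bounded section `s` of `σ`. -/

/-- `c` measures the non-linearity of some bounded section of `σ`. -/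
def HasCocycle (α : BanExtension 𝕜 F E) (c : (F × F → E) × (𝕜 × F → E)) : Prop :=
  ∃ (s : F → α.G) (C : ℝ), (∀ x, α.σ (s x) = x) ∧ (∀ x, ‖s x‖ ≤ C * ‖x‖) ∧
    (∀ x y, α.i (c.1 (x, y)) = s (x + y) - s x - s y) ∧
    ∀ a x, α.i (c.2 (a, x)) = s (a • x) - a • s x

theorem exists_hasCocycle (α : BanExtension 𝕜 F E) : ∃ c, HasCocycle α c := by
  obtain ⟨C, -, h⟩ := α.σ.exists_preimage_norm_le α.surjective
  choose s hs hb using h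
  have h1 : ∀ p : F × F, ∃ e, α.i e = s (p.1 + p.2) - s p.1 - s p.2 := fun p =>
    α.exists_of_σ_eq_zero (by simp [hs])
  have h2 : ∀ p : 𝕜 × F, ∃ e, α.i e = s (p.1 • p.2) - p.1 • s p.2 := fun p =>
    α.exists_of_σ_eq_zero (by simp [hs])
  choose c1 hc1 using h1
  choose c2 hc2 using h2
  exact ⟨(c1, c2), s, C, hs, hb, fun x y => hc1 (x, y), fun a x => hc2 (a, x)⟩

theorem congruent_of_hasCocycle {α β : BanExtension 𝕜 F E} {c : (F × F → E) × (𝕜 × F → E)}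
    (hα : HasCocycle α c) (hβ : HasCocycle β c) : Congruent α β := by
  obtain ⟨s, C, hs, hsb, hs1, hs2⟩ := hα
  obtain ⟨t, D, ht, htb, ht1, ht2⟩ := hβ
  obtain ⟨B, hB, hb⟩ := α.exists_bound
  have hr : ∀ g, ∃ e, α.i e = g - s (α.σ g) := fun g =>
    α.exists_of_σ_eq_zero (by simp [hs])
  choose r hr using hr
  let l : α.G →ₗ[𝕜] β.G :=
    { toFun := fun g => β.i (r g) + t (α.σ g)
      map_add' := fun g g' => by
        have h : r (g + g') = r g + r g' - c.1 (α.σ g, α.σ g') := by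
          apply α.injective
          simp only [map_add, map_sub, hr, hs1]
          abel
        rw [h]
        simp only [map_add, map_sub, ht1]
        abel
      map_smul' := fun a g => by
        have h : r (a • g) = a • r g - c.2 (a, α.σ g) := by
          apply α.injective
          simp only [map_smul, map_sub, hr, hs2, smul_sub]
          abel
        rw [h]
        simp only [map_smul, map_sub, ht2, RingHom.id_apply, smul_add]
        abel }
  have hl : ∀ g, ‖l g‖ ≤ (‖β.i‖ * (B * (1 + |C| * ‖α.σ‖)) + |D| * ‖α.σ‖) * ‖g‖ := by
    intro g
    have hσ := α.σ.le_opNorm g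
    have h1 : ‖s (α.σ g)‖ ≤ |C| * (‖α.σ‖ * ‖g‖) :=
      (hsb _).trans (mul_le_mul (le_abs_self C) hσ (norm_nonneg _) (abs_nonneg _))
    have h2 : ‖t (α.σ g)‖ ≤ |D| * (‖α.σ‖ * ‖g‖) :=
      (htb _).trans (mul_le_mul (le_abs_self D) hσ (norm_nonneg _) (abs_nonneg _))
    have h3 : ‖r g‖ ≤ B * (‖g‖ + |C| * (‖α.σ‖ * ‖g‖)) := by
      refine (hb _).trans (mul_le_mul_of_nonneg_left ?_ hB)
      rw [hr]
      exact (norm_sub_le _ _).trans (add_le_add le_rfl h1)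
    calc ‖l g‖ ≤ ‖β.i (r g)‖ + ‖t (α.σ g)‖ := norm_add_le _ _
      _ ≤ ‖β.i‖ * (B * (‖g‖ + |C| * (‖α.σ‖ * ‖g‖))) + |D| * (‖α.σ‖ * ‖g‖) :=
        add_le_add ((β.i.le_opNorm _).trans
          (mul_le_mul_of_nonneg_left h3 (norm_nonneg _))) h2
      _ = _ := by ring
  let h : α.G →L[𝕜] β.G := l.mkContinuous _ hl
  have hσ : ∀ g, β.σ (h g) = α.σ g := fun g => by
    change β.σ (β.i (r g) + t (α.σ g)) = α.σ g
    rw [map_add, σ_i, ht, zero_add]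
  have s0 : s 0 = 0 := norm_le_zero_iff.1 (by simpa using hsb 0)
  have t0 : t 0 = 0 := norm_le_zero_iff.1 (by simpa using htb 0)
  have hi : ∀ e, h (α.i e) = β.i e := fun e => by
    change β.i (r (α.i e)) + t (α.σ (α.i e)) = β.i e
    have : r (α.i e) = e := α.injective (by rw [hr, σ_i, s0, sub_zero])
    rw [this, σ_i, t0, add_zero]
  have hinj : h.ker = ⊥ := by
    rw [eq_bot_iff]
    intro g hg
    have hg0 : h g = 0 := hg
    obtain ⟨e, rfl⟩ := α.exists_of_σ_eq_zero (g := g) (by rw [← hσ, hg0, map_zero])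
    rw [hi] at hg0
    have : e = 0 := β.injective (by rw [hg0, map_zero])
    simp [this]
  have hsurj : h.range = ⊤ := by
    rw [eq_top_iff]
    intro g _
    obtain ⟨g', hg'⟩ := α.surjective (β.σ g)
    obtain ⟨e, he⟩ := β.exists_of_σ_eq_zero (g := g - h g') (by rw [map_sub, hσ, hg', sub_self])
    exact ⟨α.i e + g', by
      change h (α.i e + g') = g
      rw [map_add, hi, he, sub_add_cancel]⟩
  exact ⟨ContinuousLinearEquiv.ofBijective h hinj hsurj, hi, hσ⟩

theorem HasCocycle.congr {α β : BanExtension 𝕜 F E} {c : (F × F → E) × (𝕜 × F → E)}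
    (h : HasCocycle α c) (hc : Congruent α β) : HasCocycle β c := by
  obtain ⟨s, C, hs, hsb, hs1, hs2⟩ := h
  obtain ⟨k, k1, k2⟩ := hc
  refine ⟨fun x => k (s x), ‖(k : α.G →L[𝕜] β.G)‖ * C, fun x => by rw [k2, hs], fun x => ?_,
    fun x y => ?_, fun a x => ?_⟩
  · calc ‖k (s x)‖ ≤ ‖(k : α.G →L[𝕜] β.G)‖ * ‖s x‖ :=
          (k : α.G →L[𝕜] β.G).le_opNorm _
      _ ≤ ‖(k : α.G →L[𝕜] β.G)‖ * (C * ‖x‖) :=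
          mul_le_mul_of_nonneg_left (hsb x) (norm_nonneg _)
      _ = _ := by ring
  · rw [← k1, hs1, map_sub, map_sub]
  · rw [← k1, hs2, map_sub, map_smul]

theorem hasCocycle_split : HasCocycle (split 𝕜 F E) 0 := by
  refine ⟨fun x => ((0 : E), x), 1, fun x => rfl, fun x => ?_, fun x y => ?_, fun a x => ?_⟩
  · change max ‖(0 : E)‖ ‖x‖ ≤ 1 * ‖x‖
    simp
  · refine Prod.ext ?_ ?_
    · change (0 : E) = 0 - 0 - 0
      simp
    · change (0 : F) = x + y - x - y
      simp
  · refine Prod.ext ?_ ?_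
    · change (0 : E) = 0 - a • 0
      simp
    · change (0 : F) = a • x - a • x
      simp

theorem HasCocycle.add {α β : BanExtension 𝕜 F E} {c d : (F × F → E) × (𝕜 × F → E)}
    (hα : HasCocycle α c) (hβ : HasCocycle β d) : HasCocycle (α.add β) (c + d) := by
  obtain ⟨s, C, hs, hsb, hs1, hs2⟩ := hα
  obtain ⟨t, D, ht, htb, ht1, ht2⟩ := hβ
  let p : F → fibre α β := fun x => ⟨(s x, t x), sub_eq_zero.2 ((hs x).trans (ht x).symm)⟩
  have key : ∀ (e e' : E) (q : fibre α β), q.1 = (α.i e, β.i e') →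
      (α.add β).i (e + e') = Submodule.Quotient.mk q := by
    intro e e' q hq
    refine (Submodule.Quotient.eq _).2 ⟨e', Subtype.ext (Prod.ext ?_ ?_)⟩
    · change α.i e' = α.i (e + e') - q.1.1
      rw [hq, map_add, add_sub_cancel_left]
    · change -(β.i e') = 0 - q.1.2
      rw [hq, zero_sub]
  refine ⟨fun x => (Submodule.Quotient.mk (p x) : fibre α β ⧸ (addRel α β).range), max C D,
    fun x => hs x, fun x => ?_, fun x y => ?_, fun a x => ?_⟩
  · refine (Submodule.Quotient.norm_mk_le _ (p x)).trans (max_le ?_ ?_)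
    · exact (hsb x).trans (mul_le_mul_of_nonneg_right (le_max_left _ _) (norm_nonneg _))
    · exact (htb x).trans (mul_le_mul_of_nonneg_right (le_max_right _ _) (norm_nonneg _))
  · exact key _ _ (p (x + y) - p x - p y) (Prod.ext (hs1 x y).symm (ht1 x y).symm)
  · exact key _ _ (p (a • x) - a • p x) (Prod.ext (hs2 a x).symm (ht2 a x).symm)

theorem HasCocycle.smul {α : BanExtension 𝕜 F E} {c : (F × F → E) × (𝕜 × F → E)} (b : 𝕜)
    (hα : HasCocycle α c) : HasCocycle (α.smul b) (b • c) := by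
  obtain ⟨s, C, hs, hsb, hs1, hs2⟩ := hα
  let p : F → α.G × E := fun x => (s x, 0)
  have key : ∀ (e : E) (q : α.G × E), q = (α.i e, 0) →
      (α.smul b).i (b • e) = Submodule.Quotient.mk q := by
    rintro e _ rfl
    refine (Submodule.Quotient.eq _).2 ⟨-e, ?_⟩
    change (α.i (-e), -(b • -e)) = ((0 : α.G) - α.i e, b • e - 0)
    simp
  refine ⟨fun x => (Submodule.Quotient.mk (p x) : (α.G × E) ⧸ (smulRel b α).range), C,
    fun x => hs x, fun x => ?_, fun x y => ?_, fun a x => ?_⟩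
  · refine (Submodule.Quotient.norm_mk_le _ (p x)).trans ?_
    change max ‖s x‖ ‖(0 : E)‖ ≤ _
    rw [norm_zero, max_eq_left (norm_nonneg _)]
    exact hsb x
  · refine key _ (p (x + y) - p x - p y) (Prod.ext (hs1 x y).symm ?_)
    change (0 : E) - 0 - 0 = 0
    simp
  · refine key _ (p (a • x) - a • p x) (Prod.ext (hs2 a x).symm ?_)
    change (0 : E) - a • 0 = 0
    simp

end

end BanExtension

/-- `Ext¹(F, E)` in the category of Banach spaces: the congruence classes of the extensions
`0 → E → G → F → 0`. -/
def BanExt (𝕜 : Type*) [RCLike 𝕜]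
    (F : Type v) [NormedAddCommGroup F] [NormedSpace 𝕜 F]
    (E : Type u) [NormedAddCommGroup E] [NormedSpace 𝕜 E] :=
  Quotient (BanExtension.setoid 𝕜 F E)

namespace BanExt

open BanExtension

section

variable {𝕜 : Type*} [RCLike 𝕜]
  {F : Type v} [NormedAddCommGroup F] [NormedSpace 𝕜 F] [CompleteSpace F]
  {E : Type u} [NormedAddCommGroup E] [NormedSpace 𝕜 E] [CompleteSpace E]

/-- The zero of `Ext¹(F, E)` is the class of the split extension. -/
instance : Zero (BanExt 𝕜 F E) := ⟨Quotient.mk _ (split 𝕜 F E)⟩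

/-- The sum of `Ext¹(F, E)` is the Baer sum. -/
noncomputable instance : Add (BanExt 𝕜 F E) :=
  ⟨Quotient.map₂ BanExtension.add fun α α' h β β' k => by
    obtain ⟨c, hc⟩ := α.exists_hasCocycle
    obtain ⟨d, hd⟩ := β.exists_hasCocycle
    exact congruent_of_hasCocycle (hc.add hd) ((hc.congr h).add (hd.congr k))⟩

/-- Scalar multiples in `Ext¹(F, E)` are push-outs along multiples of the identity of `E`. -/
noncomputable instance : SMul 𝕜 (BanExt 𝕜 F E) :=
  ⟨fun a => Quotient.map (BanExtension.smul a) fun α α' h => by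
    obtain ⟨c, hc⟩ := α.exists_hasCocycle
    exact congruent_of_hasCocycle (hc.smul a) ((hc.congr h).smul a)⟩

noncomputable instance : Neg (BanExt 𝕜 F E) := ⟨fun x => (-1 : 𝕜) • x⟩

/-- The class `x` is represented by an extension with the given cocycle. -/
def Rep (x : BanExt 𝕜 F E) (c : (F × F → E) × (𝕜 × F → E)) : Prop :=
  ∃ α : BanExtension 𝕜 F E, Quotient.mk _ α = x ∧ HasCocycle α c

theorem exists_rep (x : BanExt 𝕜 F E) : ∃ c, Rep x c := by
  induction x using Quotient.inductionOn with
  | h α =>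
    obtain ⟨c, hc⟩ := α.exists_hasCocycle
    exact ⟨c, α, rfl, hc⟩

theorem Rep.eq {x y : BanExt 𝕜 F E} {c d : (F × F → E) × (𝕜 × F → E)} (hx : Rep x c)
    (hy : Rep y d) (h : c = d) : x = y := by
  obtain ⟨α, rfl, hα⟩ := hx
  obtain ⟨β, rfl, hβ⟩ := hy
  subst h
  exact Quotient.sound (congruent_of_hasCocycle hα hβ)

theorem rep_zero : Rep (0 : BanExt 𝕜 F E) 0 := ⟨_, rfl, hasCocycle_split⟩

theorem Rep.add {x y : BanExt 𝕜 F E} {c d : (F × F → E) × (𝕜 × F → E)} (hx : Rep x c)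
    (hy : Rep y d) : Rep (x + y) (c + d) := by
  obtain ⟨α, rfl, hα⟩ := hx
  obtain ⟨β, rfl, hβ⟩ := hy
  exact ⟨_, rfl, HasCocycle.add hα hβ⟩

theorem Rep.smul {x : BanExt 𝕜 F E} {c : (F × F → E) × (𝕜 × F → E)} (a : 𝕜) (hx : Rep x c) :
    Rep (a • x) (a • c) := by
  obtain ⟨α, rfl, hα⟩ := hx
  exact ⟨_, rfl, HasCocycle.smul a hα⟩

theorem Rep.neg {x : BanExt 𝕜 F E} {c : (F × F → E) × (𝕜 × F → E)} (hx : Rep x c) :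
    Rep (-x) ((-1 : 𝕜) • c) := hx.smul (-1)

noncomputable instance : AddCommGroup (BanExt 𝕜 F E) :=
  { AddGroup.ofLeftAxioms
      (fun x y z : BanExt 𝕜 F E => by
        obtain ⟨c, hc⟩ := exists_rep x
        obtain ⟨d, hd⟩ := exists_rep y
        obtain ⟨e, he⟩ := exists_rep z
        exact ((hc.add hd).add he).eq (hc.add (hd.add he)) (add_assoc c d e))
      (fun x => by
        obtain ⟨c, hc⟩ := exists_rep x
        exact (rep_zero.add hc).eq hc (zero_add c))
      (fun x => by
        obtain ⟨c, hc⟩ := exists_rep x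
        exact (hc.neg.add hc).eq rep_zero (by rw [neg_smul, one_smul, neg_add_cancel])) with
    add_comm := fun x y => by
      obtain ⟨c, hc⟩ := exists_rep x
      obtain ⟨d, hd⟩ := exists_rep y
      exact (hc.add hd).eq (hd.add hc) (add_comm c d) }

/-- `Ext¹(F, E)` is a vector space. -/
noncomputable instance : Module 𝕜 (BanExt 𝕜 F E) where
  one_smul x := by
    obtain ⟨c, hc⟩ := exists_rep x
    exact (hc.smul 1).eq hc (one_smul 𝕜 c)
  mul_smul a b x := by
    obtain ⟨c, hc⟩ := exists_rep x
    exact (hc.smul (a * b)).eq ((hc.smul b).smul a) (mul_smul a b c)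
  smul_zero a := (rep_zero.smul a).eq rep_zero (smul_zero a)
  smul_add a x y := by
    obtain ⟨c, hc⟩ := exists_rep x
    obtain ⟨d, hd⟩ := exists_rep y
    exact ((hc.add hd).smul a).eq ((hc.smul a).add (hd.smul a)) (smul_add a c d)
  add_smul a b x := by
    obtain ⟨c, hc⟩ := exists_rep x
    exact (hc.smul (a + b)).eq ((hc.smul a).add (hc.smul b)) (add_smul a b c)
  zero_smul x := by
    obtain ⟨c, hc⟩ := exists_rep x
    exact (hc.smul 0).eq rep_zero (zero_smul 𝕜 c)

end

end BanExt

/-- The **approximation property**: on every compact set, the identity can be approximated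
uniformly by bounded operators of finite rank. -/
def HasAP (𝕜 : Type*) [RCLike 𝕜] (E : Type*) [NormedAddCommGroup E] [NormedSpace 𝕜 E] : Prop :=
  ∀ K : Set E, IsCompact K → ∀ ε > (0 : ℝ), ∃ T : E →L[𝕜] E,
    FiniteDimensional 𝕜 T.range ∧ ∀ x ∈ K, ‖T x - x‖ < ε

/-- The **bounded approximation property**: there is a constant `C` such that on every compact
set the identity can be approximated uniformly by operators of finite rank and of norm at most
`C`. (Indexed by the pairs `(K, ε)`, these operators form a bounded net that converges to the
identity uniformly on compact sets.) -/
def HasBAP (𝕜 : Type*) [RCLike 𝕜] (E : Type*) [NormedAddCommGroup E] [NormedSpace 𝕜 E] : Prop :=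
  ∃ C : ℝ, ∀ K : Set E, IsCompact K → ∀ ε > (0 : ℝ), ∃ T : E →L[𝕜] E,
    FiniteDimensional 𝕜 T.range ∧ ‖T‖ ≤ C ∧ ∀ x ∈ K, ‖T x - x‖ < ε

/-- `E` is **reflexive**: the canonical embedding into the bidual is onto. -/
def IsReflexiveSpace (𝕜 : Type*) [RCLike 𝕜]
    (E : Type*) [NormedAddCommGroup E] [NormedSpace 𝕜 E] : Prop :=
  Function.Surjective (NormedSpace.inclusionInDoubleDual 𝕜 E)

/-- `E` is isomorphic (linearly homeomorphic) to the dual of a Banach space. (A predual embeds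
into the dual of `E`, so that it can be taken in the universe of `E`.) -/
def IsIsomorphicToDual (𝕜 : Type*) [RCLike 𝕜]
    (E : Type u) [NormedAddCommGroup E] [NormedSpace 𝕜 E] : Prop :=
  ∃ (X : Type u) (_ : NormedAddCommGroup X) (_ : NormedSpace 𝕜 X) (_ : CompleteSpace X),
    Nonempty (E ≃L[𝕜] StrongDual 𝕜 X)

/-! Let `P` be ℓ¹ on the unit ball of `F`, π : `P` → `F` the canonical quotient map and `K` its
kernel. Operators on `P` lift through quotient maps, so Ext¹(`F`, `E`) measures the obstruction to
extending operators `K` → `E` to `P`: the push-out class depends linearly on the operator and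
vanishes only if it extends (`BanExt.exists_linearMap`), and if every operator extends, then every
extension splits (`BanExt.eq_zero_of_forall_extends`).

If Ext¹ is finite-dimensional, the restriction map L(`P`, `E`) → L(`K`, `E`) has range of finite
codimension, and the open mapping theorem yields extensions of norm at most `C * ‖τ‖`
(`exists_extension_bound`). For `E` a dual space, this bound makes the set of extendable operators
closed under weak* limits of bounded families (`Extends.of_tendsto`). What remains is to approximate
an arbitrary τ by extendable operators.

If `F` has the BAP, its finite-rank operators give maps `P` → `K` whose restrictions to `K` are
bounded and tend pointwise to the identity (`Extends.of_hasBAP`). If `E` has the AP, each `T ∘ τ`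
with `T` of finite rank extends, but no bounded net of such `T` is at hand; the argument of Krein
and Šmulian replaces boundedness by uniform approximation on a null family (`Extends.of_hasAP`).
Reflexivity serves to present `E` as the dual of its dual. -/

open Filter Topology

/-! ### Lifting from `ℓ¹` -/

namespace LOne

variable {𝕜 : Type*} [RCLike 𝕜] {I : Type*}

theorem summable_norm (p : lp (fun _ : I => 𝕜) 1) : Summable fun x => ‖p x‖ := by
  simpa using (lp.memℓp p).summable (by simp)

theorem norm_eq (p : lp (fun _ : I => 𝕜) 1) : ‖p‖ = ∑' x, ‖p x‖ := by
  simpa using lp.norm_eq_tsum_rpow (by simp) p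

variable {Y : Type*} [NormedAddCommGroup Y] [NormedSpace 𝕜 Y]

theorem norm_smul_le {g : I → Y} {M : ℝ} (hg : ∀ x, ‖g x‖ ≤ M) (p : lp (fun _ : I => 𝕜) 1)
    (x : I) : ‖p x • g x‖ ≤ ‖p x‖ * M := by
  rw [norm_smul]
  exact mul_le_mul_of_nonneg_left (hg x) (norm_nonneg _)

variable [CompleteSpace Y]

theorem summable_smul {g : I → Y} {M : ℝ} (hg : ∀ x, ‖g x‖ ≤ M) (p : lp (fun _ : I => 𝕜) 1) :
    Summable fun x => p x • g x :=
  Summable.of_norm_bounded ((summable_norm p).mul_right M) (norm_smul_le hg p)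

/-- The operator on `ℓ¹` that maps the unit vectors to the elements of a bounded family. -/
noncomputable def lift (g : I → Y) (M : ℝ) (hg : ∀ x, ‖g x‖ ≤ M) :
    lp (fun _ : I => 𝕜) 1 →L[𝕜] Y :=
  LinearMap.mkContinuous
    { toFun := fun p => ∑' x, p x • g x
      map_add' := fun p q => by
        rw [← (summable_smul hg p).tsum_add (summable_smul hg q)]
        simp only [lp.coeFn_add, Pi.add_apply, add_smul]
      map_smul' := fun a p => by
        rw [RingHom.id_apply, ← (summable_smul hg p).tsum_const_smul]
        simp only [lp.coeFn_smul, Pi.smul_apply, smul_eq_mul, mul_smul] }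
    M fun p => by
      change ‖∑' x, p x • g x‖ ≤ M * ‖p‖
      rw [mul_comm, norm_eq, ← tsum_mul_right]
      exact tsum_of_norm_bounded ((summable_norm p).mul_right M).hasSum (norm_smul_le hg p)

theorem lift_apply {g : I → Y} {M : ℝ} (hg : ∀ x, ‖g x‖ ≤ M) (p : lp (fun _ : I => 𝕜) 1) :
    lift g M hg p = ∑' x, p x • g x := rfl

theorem norm_lift_apply_le {g : I → Y} {M : ℝ} (hg : ∀ x, ‖g x‖ ≤ M)
    (p : lp (fun _ : I => 𝕜) 1) : ‖lift g M hg p‖ ≤ M * ‖p‖ := by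
  rw [lift_apply, mul_comm, norm_eq, ← tsum_mul_right]
  exact tsum_of_norm_bounded ((summable_norm p).mul_right M).hasSum (norm_smul_le hg p)

theorem map_lift {Z : Type*} [NormedAddCommGroup Z] [NormedSpace 𝕜 Z] {g : I → Y} {M : ℝ}
    (hg : ∀ x, ‖g x‖ ≤ M) (q : Y →L[𝕜] Z) (p : lp (fun _ : I => 𝕜) 1) :
    q (lift g M hg p) = ∑' x, p x • q (g x) := by
  rw [lift_apply, q.map_tsum (summable_smul hg p)]
  simp only [map_smul]

theorem lift_single [DecidableEq I] {g : I → Y} {M : ℝ} (hg : ∀ x, ‖g x‖ ≤ M) (x : I) (a : 𝕜) :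
    lift g M hg (lp.single 1 x a) = a • g x := by
  rw [lift_apply, tsum_eq_single x]
  · rw [lp.single_apply_self]
  · intro y hy
    rw [lp.single_apply_ne _ _ _ hy, zero_smul]

variable (𝕜) (F : Type*) [NormedAddCommGroup F] [NormedSpace 𝕜 F] [CompleteSpace F]

/-- The canonical quotient map onto `F` of the space `ℓ¹` on the unit ball of `F`. -/
noncomputable def proj : lp (fun _ : Metric.closedBall (0 : F) 1 => 𝕜) 1 →L[𝕜] F :=
  lift (fun x => (x : F)) 1 fun x => mem_closedBall_zero_iff.1 x.2

theorem proj_surjective : Function.Surjective (proj 𝕜 F) := by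
  classical
  intro y
  by_cases hy : y = 0
  · exact ⟨0, by rw [hy, map_zero]⟩
  have hn : (‖y‖ : 𝕜) ≠ 0 := by simpa using hy
  have hb : ((‖y‖ : 𝕜)⁻¹ • y) ∈ Metric.closedBall (0 : F) 1 := by
    rw [mem_closedBall_zero_iff, norm_smul, norm_inv, RCLike.norm_ofReal, abs_norm,
      inv_mul_cancel₀ (norm_ne_zero_iff.2 hy)]
  refine ⟨lp.single 1 ⟨_, hb⟩ (‖y‖ : 𝕜), ?_⟩
  rw [proj, lift_single, smul_smul, mul_inv_cancel₀ hn, one_smul]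

variable {𝕜 F}

/-- Operators into `F` defined on a quotient of `Y` lift along `proj`, with values controlled on
the unit vectors. -/
theorem exists_lift {σ : Y →L[𝕜] F} (hσ : Function.Surjective σ) :
    ∃ C : ℝ, 0 < C ∧ ∀ T : F →L[𝕜] F, ∃ S : lp (fun _ : Metric.closedBall (0 : F) 1 => 𝕜) 1 →L[𝕜] Y,
      (∀ p, σ (S p) = T (proj 𝕜 F p)) ∧ (∀ p, ‖S p‖ ≤ C * ‖T‖ * ‖p‖) ∧
      ∀ p, ‖S p‖ ≤ ∑' x, C * (‖p x‖ * ‖T x‖) := by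
  obtain ⟨C, hC, h⟩ := σ.exists_preimage_norm_le hσ
  -- The preimages need not depend linearly on the point: any bounded family indexed by the unit
  -- ball defines an operator on ℓ¹.
  choose s hs hb using h
  refine ⟨C, hC, fun T => ?_⟩
  have hT : ∀ x : Metric.closedBall (0 : F) 1, ‖T x‖ ≤ ‖T‖ := fun x =>
    (T.le_opNorm x).trans (mul_le_of_le_one_right (norm_nonneg _) (mem_closedBall_zero_iff.1 x.2))
  have hg : ∀ x : Metric.closedBall (0 : F) 1, ‖s (T x)‖ ≤ C * ‖T‖ := fun x =>
    (hb _).trans (mul_le_mul_of_nonneg_left (hT x) hC.le)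
  refine ⟨lift (fun x => s (T x)) _ hg, fun p => ?_, norm_lift_apply_le hg, fun p => ?_⟩
  · rw [map_lift, proj, map_lift]
    simp only [hs]
  -- This termwise estimate allows dominated convergence when `T` is small pointwise but not in
  -- norm.
  · rw [lift_apply]
    have hs' : Summable fun x : Metric.closedBall (0 : F) 1 => C * (‖p x‖ * ‖T x‖) :=
      (Summable.of_nonneg_of_le (fun x => by positivity)
        (fun x => mul_le_mul_of_nonneg_left (hT x) (norm_nonneg _))
        ((summable_norm p).mul_right ‖T‖)).mul_left C
    refine tsum_of_norm_bounded hs'.hasSum fun x => ?_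
    rw [norm_smul, mul_left_comm]
    exact mul_le_mul_of_nonneg_left (hb _) (norm_nonneg _)

end LOne

/-! ### Weak* limits of bounded families of operators -/

/-- Operators into a dual space that are bounded along an ultrafilter converge to an operator in
the weak* operator topology. -/
theorem Ultrafilter.exists_tendsto_weakStar {𝕜 : Type*} [RCLike 𝕜] {P X ι : Type*}
    [NormedAddCommGroup P] [NormedSpace 𝕜 P] [NormedAddCommGroup X] [NormedSpace 𝕜 X]
    (U : Ultrafilter ι) (S : ι → P →L[𝕜] StrongDual 𝕜 X) {M : ℝ} (hM : ∀ i, ‖S i‖ ≤ M) :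
    ∃ T : P →L[𝕜] StrongDual 𝕜 X, ‖T‖ ≤ M ∧
      ∀ p x, Tendsto (fun i => S i p x) U (𝓝 (T p x)) := by
  obtain ⟨i₀, -⟩ := U.nonempty_of_mem univ_mem
  have hM0 : 0 ≤ M := (norm_nonneg (S i₀)).trans (hM i₀)
  have hb : ∀ i p x, ‖S i p x‖ ≤ M * ‖p‖ * ‖x‖ := fun i p x =>
    ((S i).le_opNorm₂ p x).trans (by gcongr; exact hM i)
  -- The scalars `S i p x` stay in a compact disc, so they converge along an ultrafilter;
  -- bilinearity passes to the limits.
  have hlim : ∀ p x, ∃ y, ‖y‖ ≤ M * ‖p‖ * ‖x‖ ∧ Tendsto (fun i => S i p x) U (𝓝 y) := by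
    intro p x
    obtain ⟨y, hy, h⟩ := (isCompact_closedBall (0 : 𝕜) (M * ‖p‖ * ‖x‖)).ultrafilter_le_nhds
      (U.map fun i => S i p x) (le_principal_iff.2 (Ultrafilter.mem_map.2 (Filter.univ_mem'
        fun i => mem_closedBall_zero_iff.2 (hb i p x))))
    exact ⟨y, mem_closedBall_zero_iff.1 hy, h⟩
  choose b hbn hbt using hlim
  let B : P →ₗ[𝕜] X →ₗ[𝕜] 𝕜 := LinearMap.mk₂ 𝕜 b
    (fun p q x => tendsto_nhds_unique (hbt (p + q) x) (by
      simpa only [map_add, add_apply] using (hbt p x).add (hbt q x)))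
    (fun a p x => tendsto_nhds_unique (hbt (a • p) x) (by
      simpa only [map_smul, smul_apply] using (hbt p x).const_smul a))
    (fun p x y => tendsto_nhds_unique (hbt p (x + y)) (by
      simpa only [map_add] using (hbt p x).add (hbt p y)))
    (fun a p x => tendsto_nhds_unique (hbt p (a • x)) (by
      simpa only [map_smul] using (hbt p x).const_smul a))
  exact ⟨B.mkContinuous₂ M hbn, B.mkContinuous₂_norm_le hM0 hbn, hbt⟩

/-! ### Restrictions of operators -/

section Restriction

variable {𝕜 : Type*} [RCLike 𝕜] {P E : Type*}
  [NormedAddCommGroup P] [NormedSpace 𝕜 P] [NormedAddCommGroup E] [NormedSpace 𝕜 E]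

/-- The operator `τ` on the subspace `K` of `P` extends to an operator on `P`. -/
def Extends {K : Submodule 𝕜 P} (τ : K →L[𝕜] E) : Prop :=
  ∃ S : P →L[𝕜] E, S.comp K.subtypeL = τ

/-- An operator whose range has finite codimension has preimages with control of the norm. -/
theorem ContinuousLinearMap.exists_preimage_norm_le_of_finiteDimensional {Y Z : Type*}
    [NormedAddCommGroup Y] [NormedSpace 𝕜 Y] [CompleteSpace Y]
    [NormedAddCommGroup Z] [NormedSpace 𝕜 Z] [CompleteSpace Z]
    {V : Type*} [AddCommGroup V] [Module 𝕜 V] [FiniteDimensional 𝕜 V] (r : Y →L[𝕜] Z)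
    (Φ : Z →ₗ[𝕜] V) (hΦ : ∀ z, Φ z = 0 → ∃ y, r y = z) :
    ∃ C : ℝ, 0 ≤ C ∧ ∀ y, ∃ y', r y' = r y ∧ ‖y'‖ ≤ C * ‖r y‖ := by
  -- The kernel of `Φ` lies in the range of `r`, so `Φ` is injective on any algebraic complement
  -- `N`. Thus `N` is finite-dimensional, hence complete, and the open mapping theorem applies to `Y
  -- × N → Z`.
  obtain ⟨N, hN⟩ := Submodule.exists_isCompl r.range
  have hNfin : FiniteDimensional 𝕜 N := by
    refine FiniteDimensional.of_injective (Φ.comp N.subtype) ?_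
    rw [injective_iff_map_eq_zero]
    intro n hn
    exact Subtype.ext (Submodule.disjoint_def.1 hN.disjoint n (hΦ n hn) n.2)
  let q : Y × N →L[𝕜] Z := r.coprod N.subtypeL
  have hqa : ∀ z, q z = r z.1 + z.2 := fun z => rfl
  have : CompleteSpace N := FiniteDimensional.complete 𝕜 N
  have hq : Function.Surjective q := by
    intro z
    have : z ∈ r.range ⊔ N := by
      rw [hN.sup_eq_top]; trivial
    obtain ⟨_, ⟨y, rfl⟩, n, hn, rfl⟩ := Submodule.mem_sup.1 this
    exact ⟨(y, ⟨n, hn⟩), rfl⟩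
  obtain ⟨C, hC, h⟩ := q.exists_preimage_norm_le hq
  refine ⟨C, hC.le, fun y => ?_⟩
  obtain ⟨⟨y', n⟩, hyn, hb⟩ := h (r y)
  rw [hqa] at hyn
  have h0 : (n : Z) = 0 := by
    refine Submodule.disjoint_def.1 hN.disjoint _ ⟨y - y', ?_⟩ n.2
    change r (y - y') = n
    rw [map_sub, ← hyn, add_sub_cancel_left]
  exact ⟨y', by rw [← hyn, h0, add_zero], (le_max_left _ _).trans hb⟩

/-- If the operators that extend have finite codimension, they extend with control of the norm. -/
theorem exists_extension_bound [CompleteSpace E] {K : Submodule 𝕜 P} {V : Type*} [AddCommGroup V]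
    [Module 𝕜 V] [FiniteDimensional 𝕜 V] (Φ : (K →L[𝕜] E) →ₗ[𝕜] V)
    (hΦ : ∀ τ, Φ τ = 0 → Extends τ) :
    ∃ C : ℝ, 0 ≤ C ∧ ∀ τ : K →L[𝕜] E, Extends τ →
      ∃ S : P →L[𝕜] E, S.comp K.subtypeL = τ ∧ ‖S‖ ≤ C * ‖τ‖ := by
  obtain ⟨C, hC, h⟩ :=
    ((ContinuousLinearMap.compL 𝕜 K P E).flip
      K.subtypeL).exists_preimage_norm_le_of_finiteDimensional Φ hΦ
  refine ⟨C, hC, ?_⟩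
  rintro τ ⟨S, rfl⟩
  exact h S

/-- Weak* limits of bounded families of operators that extend with control of the norm extend. -/
theorem Extends.of_tendsto {X : Type*} [NormedAddCommGroup X] [NormedSpace 𝕜 X]
    (e : E ≃L[𝕜] StrongDual 𝕜 X) {K : Submodule 𝕜 P} {C : ℝ} (hC : 0 ≤ C)
    (hext : ∀ τ : K →L[𝕜] E, Extends τ →
      ∃ S : P →L[𝕜] E, S.comp K.subtypeL = τ ∧ ‖S‖ ≤ C * ‖τ‖)
    {ι : Type*} (l : Filter ι) [l.NeBot] (ρ : ι → K →L[𝕜] E) {M : ℝ}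
    (hρ : ∀ i, Extends (ρ i)) (hM : ∀ i, ‖ρ i‖ ≤ M) (τ : K →L[𝕜] E)
    (hτ : ∀ k x, Tendsto (fun i => e (ρ i k) x) l (𝓝 (e (τ k) x))) : Extends τ := by
  choose S hS hSn using fun i => hext (ρ i) (hρ i)
  -- The controlled extensions are uniformly bounded, so they have a weak* limit on all of `P`; on
  -- `K` it must agree with `τ`.
  obtain ⟨T, -, hT⟩ := (Ultrafilter.of l).exists_tendsto_weakStar
    (fun i => (e : E →L[𝕜] StrongDual 𝕜 X).comp (S i))
    (M := ‖(e : E →L[𝕜] StrongDual 𝕜 X)‖ * (C * M)) fun i =>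
      (ContinuousLinearMap.opNorm_comp_le _ _).trans (by
        gcongr
        exact (hSn i).trans (by gcongr; exact hM i))
  refine ⟨(e.symm : StrongDual 𝕜 X →L[𝕜] E).comp T, ?_⟩
  ext k
  change e.symm (T k) = τ k
  rw [e.symm_apply_eq]
  ext x
  refine tendsto_nhds_unique (hT k x) ?_
  refine ((hτ k x).mono_left (Ultrafilter.of_le l)).congr fun i => ?_
  rw [← hS i]
  rfl

end Restriction

/-! ### Push-outs as extensions -/

namespace BanExtension

variable {𝕜 : Type*} [RCLike 𝕜]
  {F : Type v} [NormedAddCommGroup F] [NormedSpace 𝕜 F]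
  {E : Type u} [NormedAddCommGroup E] [NormedSpace 𝕜 E]

/-- A short exact sequence `0 → E → G → F → 0` with `G` in any universe is isomorphic to an
extension with middle space in the universe of `E × F`. -/
theorem exists_equiv {G : Type*} [NormedAddCommGroup G] [NormedSpace 𝕜 G] [CompleteSpace G]
    (i : E →L[𝕜] G) (σ : G →L[𝕜] F) (hi : Function.Injective i)
    (hex : ∀ g, σ g = 0 ↔ ∃ e, i e = g) (hσ : Function.Surjective σ) :
    ∃ (α : BanExtension 𝕜 F E) (ψ : α.G ≃L[𝕜] G), (∀ e, ψ (α.i e) = i e) ∧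
      ∀ g, σ (ψ g) = α.σ g := by
  have : Small.{max u v} G := by
    -- A set-theoretic section of `σ` writes every element of `G` by means of a pair in `E × F`.
    refine small_of_surjective (α := E × F)
      (f := fun z => i z.1 + Function.surjInv hσ z.2) fun g => ?_
    obtain ⟨e, he⟩ := (hex (g - Function.surjInv hσ (σ g))).1 (by
      rw [map_sub, Function.surjInv_eq hσ, sub_self])
    exact ⟨(e, σ g), by simp only [he, sub_add_cancel]⟩
  let ψ : Shrink.{max u v} G ≃L[𝕜] G := Shrink.continuousLinearEquiv 𝕜 G
  have : CompleteSpace (Shrink.{max u v} G) :=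
    (completeSpace_congr (e := ψ.toLinearEquiv.toEquiv) ψ.isUniformEmbedding).2 inferInstance
  refine ⟨{ G := Shrink.{max u v} G
            i := (ψ.symm : G →L[𝕜] Shrink.{max u v} G).comp i
            σ := σ.comp (ψ : Shrink.{max u v} G →L[𝕜] G)
            injective := ψ.symm.injective.comp hi
            exact := ?_
            surjective := hσ.comp ψ.surjective }, ψ, fun e => ψ.apply_symm_apply _, fun g => rfl⟩
  ext y
  change (∃ e, ψ.symm (i e) = y) ↔ σ (ψ y) = 0
  simp only [hex, ψ.symm_apply_eq]

variable [CompleteSpace E] {P : Type*} [NormedAddCommGroup P] [NormedSpace 𝕜 P] [CompleteSpace P]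

/-- The push-out of `0 → ker π → P → F → 0` along `τ : ker π → E`. -/
theorem exists_pushout {π : P →L[𝕜] F} (hπ : Function.Surjective π) (τ : π.ker →L[𝕜] E) :
    ∃ (α : BanExtension 𝕜 F E) (j : P →L[𝕜] α.G), (∀ p, α.σ (j p) = π p) ∧
      ∀ k : π.ker, j k = α.i (τ k) := by
  let f : π.ker →L[𝕜] P × E := π.ker.subtypeL.prod (-τ)
  have hf : ∀ k, f k = ((k : P), -(τ k)) := fun k => rfl
  have hcl : IsClosed (f.range : Set (P × E)) := by
    have : CompleteSpace π.ker := π.isClosed_ker.completeSpace_coe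
    -- The first coordinate of `f k` is `k` itself, so `f` does not decrease norms.
    have ha : AntilipschitzWith 1 f := by
      refine AddMonoidHomClass.antilipschitz_of_bound f fun k => ?_
      rw [NNReal.coe_one, one_mul]
      exact le_max_left ‖(k : P)‖ ‖-(τ k)‖
    exact ha.isClosed_range f.uniformContinuous
  have hmk : ∀ z : P × E, f.range.mkQL z = 0 ↔ ∃ k, f k = z := fun z =>
    Submodule.Quotient.mk_eq_zero _
  let i : E →L[𝕜] (P × E) ⧸ f.range := f.range.mkQL.comp (ContinuousLinearMap.inr 𝕜 P E)
  let σ : (P × E) ⧸ f.range →L[𝕜] F := f.range.liftQL (π.comp (ContinuousLinearMap.fst 𝕜 P E)) (by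
    rintro _ ⟨k, rfl⟩
    exact k.2)
  have hij : ∀ k : π.ker, f.range.mkQL ((k : P), (0 : E)) = i (τ k) := fun k => by
    refine (Submodule.Quotient.eq _).2 ⟨k, ?_⟩
    change f k = ((k : P), (0 : E)) - (0, τ k)
    simp [hf]
  obtain ⟨α, ψ, h1, h2⟩ := exists_equiv i σ
    (by
      rw [injective_iff_map_eq_zero]
      intro x hx
      obtain ⟨k, hk⟩ := (hmk _).1 hx
      have h1 : (k : P) = 0 := congrArg Prod.fst hk
      have h2 : -(τ k) = x := congrArg Prod.snd hk
      rw [← h2, show k = 0 from Subtype.ext h1, map_zero, neg_zero])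
    (by
      intro g
      obtain ⟨⟨p, x⟩, rfl⟩ := Submodule.Quotient.mk_surjective _ g
      constructor
      · intro hg
        refine ⟨τ ⟨p, hg⟩ + x, ?_⟩
        rw [map_add, ← hij]
        change f.range.mkQL (p, 0) + f.range.mkQL (0, x) = f.range.mkQL (p, x)
        rw [← map_add]
        simp
      · rintro ⟨e, he⟩
        rw [← he]
        exact π.map_zero)
    (by
      intro y
      obtain ⟨p, hp⟩ := hπ y
      exact ⟨Submodule.Quotient.mk (p, 0), hp⟩)
  refine ⟨α, ((ψ.symm : _ →L[𝕜] α.G).comp f.range.mkQL).comp (ContinuousLinearMap.inl 𝕜 P E),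
    fun p => ?_, fun k => ?_⟩
  · rw [← h2]
    change σ (ψ (ψ.symm (f.range.mkQL (p, 0)))) = π p
    rw [ψ.apply_symm_apply]
    rfl
  · change ψ.symm (f.range.mkQL ((k : P), (0 : E))) = α.i (τ k)
    rw [ψ.symm_apply_eq, h1, hij]

end BanExtension

/-! ### Ext¹ as the obstruction to extending operators from a kernel -/

section

variable {𝕜 : Type*} [RCLike 𝕜]
  {F : Type v} [NormedAddCommGroup F] [NormedSpace 𝕜 F] [CompleteSpace F]
  {E : Type u} [NormedAddCommGroup E] [NormedSpace 𝕜 E] [CompleteSpace E]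

/-- The classes of the push-outs of `0 → ker π → P → F → 0` depend linearly on the operator
`ker π → E`, and only operators that extend to `P` give the class zero. -/
theorem BanExt.exists_linearMap {P : Type*} [NormedAddCommGroup P] [NormedSpace 𝕜 P]
    [CompleteSpace P] {π : P →L[𝕜] F} (hπ : Function.Surjective π) :
    ∃ Φ : (π.ker →L[𝕜] E) →ₗ[𝕜] BanExt 𝕜 F E, ∀ τ, Φ τ = 0 → Extends τ := by
  obtain ⟨C, -, h⟩ := π.exists_preimage_norm_le hπ
  choose s hs hb using h
  -- One bounded section of `π` serves for all `τ`: the push-out along `τ` has as cocycle the image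
  -- under `τ` of this fixed one, which is linear in `τ`.
  let c1 : F × F → π.ker := fun z => ⟨s (z.1 + z.2) - s z.1 - s z.2, by
    change π _ = 0
    simp [hs]⟩
  let c2 : 𝕜 × F → π.ker := fun z => ⟨s (z.1 • z.2) - z.1 • s z.2, by
    change π _ = 0
    simp [hs]⟩
  let c : (π.ker →L[𝕜] E) → (F × F → E) × (𝕜 × F → E) := fun τ =>
    (fun z => τ (c1 z), fun z => τ (c2 z))
  have hx : ∀ τ : π.ker →L[𝕜] E, ∃ x : BanExt 𝕜 F E, Rep x (c τ) ∧ (x = 0 → Extends τ) := by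
    intro τ
    obtain ⟨α, j, hj, hjk⟩ := BanExtension.exists_pushout hπ τ
    refine ⟨Quotient.mk _ α, ⟨α, rfl, fun x => j (s x), ‖j‖ * C, fun x => ?_, fun x => ?_,
      fun x y => ?_, fun a x => ?_⟩, fun h0 => ?_⟩
    · rw [hj, hs]
    · rw [mul_assoc]
      exact (j.le_opNorm _).trans (mul_le_mul_of_nonneg_left (hb x) (norm_nonneg _))
    · change α.i (τ (c1 (x, y))) = _
      rw [← hjk]
      simp [c1]
    · change α.i (τ (c2 (a, x))) = _
      rw [← hjk]
      simp [c2]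
    · obtain ⟨k, hk, -⟩ := Quotient.exact h0
      -- A splitting retracts the middle space onto `E`; composed with `j`, the retraction extends
      -- `τ`.
      refine ⟨((ContinuousLinearMap.fst 𝕜 E F).comp
        (k : α.G →L[𝕜] (BanExtension.split 𝕜 F E).G)).comp j, ?_⟩
      ext z
      change (k (j z)).1 = τ z
      rw [hjk, hk]
      rfl
  choose Φ hΦ hΦ0 using hx
  exact ⟨{ toFun := Φ
           map_add' := fun τ τ' => (hΦ _).eq ((hΦ τ).add (hΦ τ')) rfl
           map_smul' := fun a τ => (hΦ _).eq ((hΦ τ).smul a) rfl }, hΦ0⟩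

/-- If all operators on the kernel of the canonical map `ℓ¹ → F` extend to `ℓ¹`, then all
extensions split. -/
theorem BanExt.eq_zero_of_forall_extends
    (h : ∀ τ : (LOne.proj 𝕜 F).ker →L[𝕜] E, Extends τ) (x : BanExt 𝕜 F E) : x = 0 := by
  obtain ⟨α, rfl⟩ := Quotient.exists_rep x
  obtain ⟨_, -, hlift⟩ := LOne.exists_lift α.surjective
  obtain ⟨S, hS, -, -⟩ := hlift (ContinuousLinearMap.id 𝕜 F)
  obtain ⟨A, hA⟩ : ∃ A : E ≃L[𝕜] α.i.range, ∀ e, (A e : α.G) = α.i e := by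
    have hcl : IsClosed (Set.range α.i) := by
      have h : (Set.range α.i) = (α.σ.ker : Set α.G) := by
        rw [← α.exact]; rfl
      rw [h]
      exact α.σ.isClosed_ker
    exact ⟨α.i.equivRange α.injective hcl, fun e => rfl⟩
  have hmem : ∀ k : (LOne.proj 𝕜 F).ker, S k ∈ α.i.range := fun k => by
    rw [α.exact]
    change α.σ (S k) = 0
    rw [hS]
    exact k.2
  obtain ⟨T, hT⟩ := h ((A.symm : α.i.range →L[𝕜] E).comp
    ((S.comp (LOne.proj 𝕜 F).ker.subtypeL).codRestrict α.i.range hmem))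
  have hTk : ∀ k : (LOne.proj 𝕜 F).ker, α.i (T k) = S k := fun k => by
    have h1 : T k = A.symm ⟨S k, hmem k⟩ := DFunLike.congr_fun hT k
    rw [h1, ← hA, A.apply_symm_apply]
  -- `D` still lifts `proj` through `σ` but now vanishes on its kernel, so `D (s y)` is a bounded
  -- linear section of `σ` although `s` is not linear.
  let D := S - α.i.comp T
  obtain ⟨C, hC, hp⟩ := (LOne.proj 𝕜 F).exists_preimage_norm_le (LOne.proj_surjective 𝕜 F)
  choose s hs hb using hp
  have hD : ∀ p q, LOne.proj 𝕜 F p = LOne.proj 𝕜 F q → D p = D q := fun p q hpq => by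
    have hk : LOne.proj 𝕜 F (p - q) = 0 := by rw [map_sub, hpq, sub_self]
    have h1 : α.i (T (p - q)) = S (p - q) := hTk ⟨p - q, hk⟩
    rw [← sub_eq_zero, ← map_sub]
    change S (p - q) - α.i (T (p - q)) = 0
    rw [h1, sub_self]
  have hσ : ∀ p, α.σ (D p) = LOne.proj 𝕜 F p := fun p => by
    change α.σ (S p - α.i (T p)) = _
    rw [map_sub, α.σ_i, sub_zero, hS]
    rfl
  refine Quotient.sound (BanExtension.congruent_of_hasCocycle
    (c := 0) ⟨fun y => D (s y), ‖D‖ * C, fun y => ?_, fun y => ?_, fun y z => ?_, fun a y => ?_⟩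
    BanExtension.hasCocycle_split)
  · rw [hσ, hs]
  · rw [mul_assoc]
    exact (D.le_opNorm _).trans (mul_le_mul_of_nonneg_left (hb y) (norm_nonneg _))
  · change α.i 0 = D (s (y + z)) - D (s y) - D (s z)
    rw [map_zero, hD (s (y + z)) (s y + s z) (by simp [hs]), map_add]
    abel
  · change α.i 0 = D (s (a • y)) - a • D (s y)
    rw [map_zero, hD (s (a • y)) (a • s y) (by simp [hs]), map_smul, sub_self]

end

/-! ### The two approximation arguments -/

/-- An operator on a subspace that factors through an operator of finite rank extends. -/
theorem Extends.comp_of_finiteDimensional {𝕜 : Type*} [RCLike 𝕜] {P E : Type*}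
    [NormedAddCommGroup P] [NormedSpace 𝕜 P] [NormedAddCommGroup E] [NormedSpace 𝕜 E]
    {K : Submodule 𝕜 P} (T : E →L[𝕜] E) [FiniteDimensional 𝕜 T.range] (τ : K →L[𝕜] E) :
    Extends (T.comp τ) := by
  have : FiniteDimensional 𝕜 (T.comp τ).range :=
    Submodule.finiteDimensional_of_le (S₂ := T.range) (by
      rintro _ ⟨k, rfl⟩
      exact ⟨τ k, rfl⟩)
  obtain ⟨S, hS⟩ := (T.comp τ).exist_extension_of_finiteDimensional_range
  exact ⟨S, hS.symm⟩

/-- Operators into a dual space that extend from the kernel of `ℓ¹ → F` with control of the norm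
contain all operators if `F` has the bounded approximation property. -/
theorem Extends.of_hasBAP {𝕜 : Type*} [RCLike 𝕜] {F : Type*} [NormedAddCommGroup F]
    [NormedSpace 𝕜 F] [CompleteSpace F] {E : Type*} [NormedAddCommGroup E] [NormedSpace 𝕜 E]
    {X : Type*} [NormedAddCommGroup X] [NormedSpace 𝕜 X] (e : E ≃L[𝕜] StrongDual 𝕜 X)
    (hF : HasBAP 𝕜 F) {C : ℝ} (hC : 0 ≤ C)
    (hext : ∀ τ : (LOne.proj 𝕜 F).ker →L[𝕜] E, Extends τ →
      ∃ S : _ →L[𝕜] E, S.comp (LOne.proj 𝕜 F).ker.subtypeL = τ ∧ ‖S‖ ≤ C * ‖τ‖)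
    (τ : (LOne.proj 𝕜 F).ker →L[𝕜] E) : Extends τ := by
  classical
  obtain ⟨B, hB⟩ := hF
  have hB' : ∀ i : Finset F × ℕ, ∃ T : F →L[𝕜] F, FiniteDimensional 𝕜 T.range ∧ ‖T‖ ≤ B ∧
      ∀ x ∈ i.1, ‖T x - x‖ < 1 / ((i.2 : ℝ) + 1) := fun i =>
    hB i.1 i.1.finite_toSet.isCompact _ Nat.one_div_pos_of_nat
  choose T hTf hTB hT using hB'
  obtain ⟨D, hD, hlift⟩ := LOne.exists_lift (LOne.proj_surjective 𝕜 F)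
  -- `L i` lifts `(1 - T i) ∘ proj`. It is uniformly bounded and tends to zero pointwise, by
  -- dominated convergence in the sum over the unit ball.
  choose L hL hLb hLs using fun i => hlift (ContinuousLinearMap.id 𝕜 F - T i)
  have hT1 : ∀ i, ‖ContinuousLinearMap.id 𝕜 F - T i‖ ≤ 1 + B := fun i =>
    (norm_sub_le _ _).trans (add_le_add ContinuousLinearMap.norm_id_le (hTB i))
  have hB1 : 0 ≤ 1 + B := (norm_nonneg _).trans (hT1 (∅, 0))
  have hTlim : ∀ x, Tendsto (fun i => ‖(ContinuousLinearMap.id 𝕜 F - T i) x‖) atTop (𝓝 0) := by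
    intro x
    rw [Metric.tendsto_nhds]
    intro ε hε
    obtain ⟨n, hn⟩ := exists_nat_one_div_lt hε
    filter_upwards [eventually_ge_atTop (({x}, n) : Finset F × ℕ)] with i hi
    rw [dist_zero_right, norm_norm]
    change ‖x - T i x‖ < ε
    rw [norm_sub_rev]
    refine (hT i x (hi.1 (Finset.mem_singleton_self x))).trans (lt_of_le_of_lt ?_ hn)
    exact Nat.one_div_le_one_div hi.2
  have hLlim : ∀ p, Tendsto (fun i => L i p) atTop (𝓝 0) := by
    intro p
    refine squeeze_zero_norm (fun i => hLs i p) ?_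
    have h0 : ∑' x : Metric.closedBall (0 : F) 1, D * (‖p x‖ * 0) = 0 := by simp
    rw [← h0]
    refine tendsto_tsum_of_dominated_convergence
      (bound := fun x => D * (‖p x‖ * (1 + B)))
      (((LOne.summable_norm p).mul_right _).mul_left _)
      (fun x => ((hTlim x).const_mul _).const_mul _) (Eventually.of_forall fun i x => ?_)
    rw [Real.norm_of_nonneg (by positivity)]
    gcongr
    refine ((ContinuousLinearMap.le_opNorm _ _).trans ?_)
    calc _ ≤ (1 + B) * 1 := by
          gcongr
          · exact hT1 i
          · exact mem_closedBall_zero_iff.1 x.2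
      _ = 1 + B := mul_one _
  -- This algebraic section may be discontinuous, but it is used only on the finite-dimensional
  -- ranges of the `T i`. The resulting lifts `V i` of `T i ∘ proj` have no uniform bound.
  obtain ⟨s, hs⟩ := LinearMap.exists_rightInverse_of_surjective
    (LOne.proj 𝕜 F).toLinearMap (LinearMap.range_eq_top.2 (LOne.proj_surjective 𝕜 F))
  let V := fun i => (LinearMap.toContinuousLinearMap (s.comp (T i).range.subtype)).comp
    (((T i).comp (LOne.proj 𝕜 F)).codRestrict (T i).range fun p => ⟨_, rfl⟩)
  have hVs : ∀ i p, V i p = s (T i (LOne.proj 𝕜 F p)) := fun i p => rfl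
  have hV : ∀ i p, LOne.proj 𝕜 F (V i p) = T i (LOne.proj 𝕜 F p) := fun i p => by
    rw [hVs]
    exact DFunLike.congr_fun hs _
  let J := ContinuousLinearMap.id 𝕜 (lp (fun _ : Metric.closedBall (0 : F) 1 => 𝕜) 1)
  have hW : ∀ i p, (J - L i - V i) p ∈ (LOne.proj 𝕜 F).ker := by
    intro i p
    change LOne.proj 𝕜 F (p - L i p - V i p) = 0
    rw [map_sub, map_sub, hL, hV]
    change LOne.proj 𝕜 F p - (LOne.proj 𝕜 F p - T i (LOne.proj 𝕜 F p)) - T i (LOne.proj 𝕜 F p) = 0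
    abel
  -- On the kernel `V i` vanishes, so there `W i` is `1 - L i`: bounded in `i` and convergent to the
  -- identity. The extension `τ ∘ W i` shows extendability only; its norm is uncontrolled, hence the
  -- need for `hext`.
  let W := fun i => (J - L i - V i).codRestrict _ (hW i)
  have hWk : ∀ i (k : (LOne.proj 𝕜 F).ker), (W i k.1).1 = k.1 - L i k.1 := fun i k => by
    change k.1 - L i k.1 - V i k.1 = _
    rw [hVs, show LOne.proj 𝕜 F k.1 = 0 from k.2, map_zero, map_zero, sub_zero]
  refine Extends.of_tendsto e hC hext (atTop : Filter (Finset F × ℕ))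
    (fun i => (τ.comp (W i)).comp (LOne.proj 𝕜 F).ker.subtypeL)
    (M := ‖τ‖ * (1 + D * (1 + B))) (fun i => ⟨_, rfl⟩) (fun i => ?_) τ fun k x => ?_
  · refine ContinuousLinearMap.opNorm_le_bound _ (by positivity) fun k => ?_
    change ‖τ (W i k)‖ ≤ _
    rw [mul_assoc]
    refine (τ.le_opNorm _).trans (mul_le_mul_of_nonneg_left ?_ (norm_nonneg τ))
    change ‖(W i k.1).1‖ ≤ (1 + D * (1 + B)) * ‖k.1‖
    rw [hWk, add_mul, one_mul]
    refine (norm_sub_le _ _).trans (add_le_add le_rfl ((hLb i k).trans ?_))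
    gcongr
    · exact hT1 i
  · have h1 : Tendsto (fun i => W i k) atTop (𝓝 k) := by
      rw [tendsto_subtype_rng]
      simp only [hWk]
      simpa using tendsto_const_nhds.sub (hLlim k)
    have h2 : Continuous fun z => e (τ z) x :=
      (ContinuousLinearMap.apply 𝕜 𝕜 x).continuous.comp (e.continuous.comp τ.continuous)
    exact (h2.tendsto k).comp h1

/-- Operators into a dual space that extend with control of the norm contain all operators if the
dual space has the approximation property. The proof follows that of the Krein–Šmulian theorem. -/
theorem Extends.of_hasAP {𝕜 : Type*} [RCLike 𝕜] {P E X : Type*} [NormedAddCommGroup P]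
    [NormedSpace 𝕜 P] [NormedAddCommGroup E] [NormedSpace 𝕜 E]
    [NormedAddCommGroup X] [NormedSpace 𝕜 X] (e : E ≃L[𝕜] StrongDual 𝕜 X)
    (hE : HasAP 𝕜 E) {K : Submodule 𝕜 P} {C : ℝ} (hC : 0 ≤ C)
    (hext : ∀ τ : K →L[𝕜] E, Extends τ →
      ∃ S : P →L[𝕜] E, S.comp K.subtypeL = τ ∧ ‖S‖ ≤ C * ‖τ‖)
    (τ : K →L[𝕜] E) : Extends τ := by
  classical
  by_contra hτ
  let e₁ : E →L[𝕜] StrongDual 𝕜 X := e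
  let e₂ : StrongDual 𝕜 X →L[𝕜] E := e.symm
  have he₂ : ∀ y, e (e₂ y) = y := e.apply_symm_apply
  -- `Q` is closed under bounded weak* limits, and it contains `e ∘ (T - 1)` for each `T` of finite
  -- rank. The aim is to separate it from zero by a null family.
  let Q : (E →L[𝕜] StrongDual 𝕜 X) → Prop := fun S => Extends (τ + (e₂.comp S).comp τ)
  have hQn : ∀ (S : E →L[𝕜] StrongDual 𝕜 X) (R : ℝ), ‖S‖ ≤ R →
      ‖τ + (e₂.comp S).comp τ‖ ≤ ‖τ‖ + ‖e₂‖ * R * ‖τ‖ := by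
    intro S R hR
    refine (norm_add_le _ _).trans (add_le_add le_rfl ?_)
    refine (ContinuousLinearMap.opNorm_comp_le _ _).trans ?_
    gcongr
    refine (ContinuousLinearMap.opNorm_comp_le _ _).trans ?_
    gcongr
  have hQe : ∀ (S : E →L[𝕜] StrongDual 𝕜 X) k x, e ((τ + (e₂.comp S).comp τ) k) x =
      e (τ k) x + S (τ k) x := fun S k x => by
    change e (τ k + e₂ (S (τ k))) x = _
    rw [map_add, he₂]
    rfl
  -- Otherwise members of `Q` tending to zero in norm would show that `τ` extends.
  obtain ⟨r, hr, hQr⟩ : ∃ r : ℝ, 0 < r ∧ ∀ S, ‖S‖ ≤ r → ¬ Q S := by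
    by_contra! h
    choose S hS hSQ using fun n : ℕ => h (1 / ((n : ℝ) + 1)) Nat.one_div_pos_of_nat
    refine hτ (Extends.of_tendsto e hC hext atTop _ hSQ (fun n => hQn (S n) 1
      ((hS n).trans ?_)) τ fun k x => ?_)
    · simpa using Nat.one_div_le_one_div (α := ℝ) (Nat.zero_le n)
    · simp only [hQe]
      have h0 : Tendsto (fun n => S n (τ k) x) atTop (𝓝 0) := by
        refine squeeze_zero_norm (a := fun n : ℕ => 1 / ((n : ℝ) + 1) * (‖τ k‖ * ‖x‖))
          (fun n => ((S n).le_opNorm₂ (τ k) x).trans ?_) ?_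
        · rw [mul_assoc]
          gcongr
          exact hS n
        · simpa using
            (tendsto_one_div_add_atTop_nhds_zero_nat (𝕜 := ℝ)).mul_const (‖τ k‖ * ‖x‖)
      simpa using tendsto_const_nhds.add h0
  -- The radius is chosen so that an operator bounded by 1 on `B n` has norm at most `r * (n + 1)`.
  let B : ℕ → Set (E × X) := fun n => {z | ‖z.1‖ ≤ (r * (n + 1))⁻¹ ∧ ‖z.2‖ ≤ 1}
  let Pol : ℕ → Finset (E × X) → Prop := fun n G => ∀ S, ‖S‖ ≤ r * (n + 1) → Q S →
    ¬ ∀ z ∈ G, ‖S z.1 z.2‖ ≤ 1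
  -- Krein–Šmulian step: if no finite part of `B n` sufficed, the counterexamples for all finite
  -- parts would have a weak* limit in `Q` that is bounded by 1 on `G` and on all of `B n`. Its norm
  -- is then at most `r * (n + 1)`, against `Pol n G`.
  have hstep : ∀ n G, Pol n G → ∃ G', Pol (n + 1) G' ∧ G ⊆ G' ∧ ∀ z ∈ G', z ∉ G → z ∈ B n := by
    intro n G hG
    by_contra! h
    have h' : ∀ H : Finset (B n), ∃ S, ‖S‖ ≤ r * ((n + 1 : ℕ) + 1) ∧ Q S ∧
        ∀ z ∈ G ∪ H.image Subtype.val, ‖S z.1 z.2‖ ≤ 1 := by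
      intro H
      by_contra! hH
      obtain ⟨z, hz, hzG, hzB⟩ := h (G ∪ H.image Subtype.val)
        (fun S h1 h2 h3 => by
          obtain ⟨z, hz, hz'⟩ := hH S h1 h2
          exact (h3 z hz).not_gt hz') Finset.subset_union_left
      obtain ⟨w, -, rfl⟩ := Finset.mem_image.1 ((Finset.mem_union.1 hz).resolve_left hzG)
      exact hzB w.2
    choose S hSn hSQ hS using h'
    obtain ⟨S₀, -, hlim⟩ := (Ultrafilter.of atTop).exists_tendsto_weakStar S hSn
    have hQS : Q S₀ := Extends.of_tendsto e hC hext 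
      ((Ultrafilter.of atTop : Ultrafilter (Finset (B n))) : Filter _) _ hSQ (fun H => hQn _ _ (hSn H)) _ fun k x => by
        simp only [hQe]
        exact tendsto_const_nhds.add (hlim (τ k) x)
    refine hG S₀ ?_ hQS fun z hz => le_of_tendsto (hlim z.1 z.2).norm
      (Eventually.of_forall fun H => hS H z (Finset.mem_union_left _ hz))
    have hB : ∀ z ∈ B n, ‖S₀ z.1 z.2‖ ≤ 1 := fun z hz => by
      refine le_of_tendsto (hlim z.1 z.2).norm (Ultrafilter.of_le _ ?_)
      filter_upwards [eventually_ge_atTop ({⟨z, hz⟩} : Finset (B n))] with H hH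
      exact hS H z (Finset.mem_union_right _ (Finset.mem_image_of_mem Subtype.val
        (hH (Finset.mem_singleton_self _))))
    have hc : 0 < r * (n + 1) := by positivity
    refine ContinuousLinearMap.opNorm_le_of_unit_norm hc.le fun p hp =>
      ContinuousLinearMap.opNorm_le_of_unit_norm hc.le fun x hx => ?_
    have hcn : ‖(((r * (n + 1))⁻¹ : ℝ) : 𝕜)‖ = (r * (n + 1))⁻¹ := by
      rw [RCLike.norm_ofReal, abs_of_pos (inv_pos.2 hc)]
    have h1 := hB (((((r * (n + 1))⁻¹ : ℝ) : 𝕜) • p), x) ⟨by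
      rw [norm_smul, hp, mul_one, hcn], hx.le⟩
    rw [map_smul, smul_apply, norm_smul, hcn, inv_mul_le_iff₀ hc, mul_one] at h1
    exact h1
  choose! g hgP hgs hgB using hstep
  let G : ℕ → Finset (E × X) := fun n => Nat.rec ∅ (fun n H => g n H) n
  have hGP : ∀ n, Pol n (G n) := by
    intro n
    induction n with
    | zero => exact fun S hS hSQ => absurd hSQ (hQr S (by simpa using hS))
    | succ n ih => exact hgP n _ ih
  have hmono : Monotone G := monotone_nat_of_le_succ fun n => hgs n _ (hGP n)
  have hGB : ∀ n, ∀ z ∈ G (n + 1), z ∉ G n → z ∈ B n := fun n => hgB n _ (hGP n)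
  have hG2 : ∀ n, ∀ z ∈ G n, ‖z.2‖ ≤ 1 := by
    intro n
    induction n with
    | zero => exact fun z hz => absurd hz (Finset.notMem_empty z)
    | succ n ih =>
      intro z hz
      rcases Classical.em (z ∈ G n) with h | h
      · exact ih z h
      · exact (hGB n z hz h).2
  have hG1 : ∀ N n, ∀ z ∈ G n, z ∈ G N ∨ ‖z.1‖ ≤ (r * (N + 1))⁻¹ := by
    intro N n
    induction n with
    | zero => exact fun z hz => absurd hz (Finset.notMem_empty z)
    | succ n ih =>
      intro z hz
      rcases Classical.em (z ∈ G n) with h | h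
      · exact ih z h
      · rcases lt_or_ge n N with hn | hn
        · exact Or.inl (hmono hn hz)
        · refine Or.inr ((hGB n z hz h).1.trans ?_)
          gcongr
  -- Beyond each stage only points with small first component are added, so the first components
  -- form a null family, and adjoining zero makes it compact.
  let f : {z : E × X // ∃ n, z ∈ G n} → E := fun z => z.1.1
  have hf : Tendsto f cofinite (𝓝 0) := by
    rw [Metric.tendsto_nhds]
    intro ε hε
    obtain ⟨N, hN⟩ := exists_nat_one_div_lt (mul_pos hr hε)
    refine ((G N).finite_toSet.preimage Subtype.val_injective.injOn).subset ?_
    rintro ⟨z, n, hz⟩ hzε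
    refine (hG1 N n z hz).resolve_right fun h => hzε ?_
    change dist z.1 0 < ε
    rw [dist_zero_right]
    refine h.trans_lt ?_
    rw [mul_inv, inv_mul_lt_iff₀ hr]
    simpa using hN
  obtain ⟨T, hTf, hT⟩ := hE _ hf.isCompact_insert_range_of_cofinite (‖e₁‖ + 1)⁻¹ (by positivity)
  let S := e₁.comp (T - ContinuousLinearMap.id 𝕜 E)
  -- However large `‖S‖` is, some stage `n` covers it; the approximation by `T` was fixed on all
  -- stages at once, so no bound on `‖T‖` is needed.
  obtain ⟨n, hn⟩ := exists_nat_ge (‖S‖ / r)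
  refine hGP n S ?_ ?_ fun z hz => ?_
  · rw [div_le_iff₀ hr] at hn
    nlinarith
  · have : τ + (e₂.comp S).comp τ = T.comp τ := by
      ext k
      change τ k + e.symm (e (T (τ k) - τ k)) = T (τ k)
      rw [e.symm_apply_apply, add_sub_cancel]
    change Extends _
    rw [this]
    exact Extends.comp_of_finiteDimensional T τ
  · have h1 : ‖T z.1 - z.1‖ < (‖e₁‖ + 1)⁻¹ :=
      hT _ (Set.mem_insert_of_mem _ ⟨⟨z, n, hz⟩, rfl⟩)
    calc ‖S z.1 z.2‖ ≤ ‖e₁ (T z.1 - z.1)‖ * ‖z.2‖ := ContinuousLinearMap.le_opNorm _ _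
      _ ≤ (‖e₁‖ * (‖e₁‖ + 1)⁻¹) * 1 := by
        gcongr
        · exact (e₁.le_opNorm _).trans (by gcongr)
        · exact hG2 n z hz
      _ ≤ 1 := by
        rw [mul_one, ← div_eq_mul_inv, div_le_one (by positivity)]
        linarith

/-! ### The dichotomy for Ext¹ -/

theorem theorem6 {𝕜 : Type*} [RCLike 𝕜]
    (E : Type u) [NormedAddCommGroup E] [NormedSpace 𝕜 E] [CompleteSpace E]
    (F : Type v) [NormedAddCommGroup F] [NormedSpace 𝕜 F] [CompleteSpace F]
    (h : (IsReflexiveSpace 𝕜 E ∧ HasAP 𝕜 E) ∨ (IsIsomorphicToDual 𝕜 E ∧ HasBAP 𝕜 F)) :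
    (∀ α : BanExt 𝕜 F E, α = 0) ∨ ¬ FiniteDimensional 𝕜 (BanExt 𝕜 F E) := by
  by_cases hfin : FiniteDimensional 𝕜 (BanExt 𝕜 F E)
  · refine Or.inl (BanExt.eq_zero_of_forall_extends ?_)
    obtain ⟨Φ, hΦ⟩ := BanExt.exists_linearMap (E := E) (LOne.proj_surjective 𝕜 F)
    obtain ⟨C, hC, hext⟩ := exists_extension_bound Φ hΦ
    rcases h with ⟨hr, hE⟩ | ⟨⟨X, _, _, _, ⟨e⟩⟩, hF⟩
    -- The predual is the dual of `E`.
    · let e := LinearIsometryEquiv.ofSurjective (NormedSpace.inclusionInDoubleDualLi (E := E) 𝕜) hr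
      exact Extends.of_hasAP e.toContinuousLinearEquiv hE hC hext
    · exact Extends.of_hasBAP e hF hC hext
  · exact Or.inr hfin
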